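/- Let $R>0$ and let $\Omega=\mathbb R^3\times(-\pi R,\pi R)\subset\mathbb R^4$ be the parametrization of the space $\mathbb R^3\times S^1$ with a compactified extra dimension, where $S^1$ is a circle of radius $R$. Let $W\in L^\infty(\Omega)$ be real-valued, let $$V(x)=-\frac1{|x|^2}+W(x),\qquad x\in\Omega\setminus\{0\},$$ and let $Z>1$. In the complex Hilbert space $L^2(\Omega)$ consider the symmetric operator $$H_{\min}=-\Delta+ZV,\qquad \operatorname{Dom}(H_{\min})=C_c^\infty(\Omega\setminus\{0\}).$$ Then the spectrum of every self-adjoint extension $H$ of $H_{\min}$ is unbounded from below and unbounded from above; that is, $\sigma(H)\cap\mathbb R$ has neither a lower nor an upper bound. -/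

import Mathlib

open MeasureTheory TopologicalSpace
open scoped ENNReal ContDiff Laplacian InnerProductSpace Distributions

noncomputable section

namespace CompactHydrogen

/-- The space `ℝ⁴` with its Euclidean norm. The coordinate `x 3` is the extra dimension. -/
abbrev E4 : Type := EuclideanSpace ℝ (Fin 4)

/-- The parametrized configuration space `Ω = ℝ³ × (-πR, πR)`. -/
def Omega (R : ℝ) : Opens E4 where
  carrier := {x | -(Real.pi * R) < x 3 ∧ x 3 < Real.pi * R}
  is_open' :=
    have h : Continuous fun x : E4 => x 3 := by fun_prop
    (isOpen_lt continuous_const h).inter (isOpen_lt h continuous_const)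

/-- The open set `Ω ∖ {0}`. -/
def puncturedOmega (R : ℝ) : Opens E4 where
  carrier := (Omega R : Set E4) \ {0}
  is_open' := (Omega R).isOpen.sdiff isClosed_singleton

/-- Lebesgue measure on `Ω`. -/
abbrev vol (R : ℝ) : Measure E4 := volume.restrict (Omega R : Set E4)

/-- The Hilbert space `L²(Ω)` of complex-valued functions. -/
abbrev L2 (R : ℝ) : Type := Lp ℂ 2 (vol R)

/-- The space `L^∞(Ω)` of real-valued functions. -/
abbrev LInf (R : ℝ) : Type := Lp ℝ ∞ (vol R)

/-- The potential `V(x) = -1/|x|² + W(x)`. -/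
def potential {R : ℝ} (W : LInf R) (x : E4) : ℝ := -1 / ‖x‖ ^ 2 + W x

/-- The expression `-Δφ + Z V φ`. -/
def schrodinger {R : ℝ} (Z : ℝ) (W : LInf R) (φ : E4 → ℂ) (x : E4) : ℂ :=
  -(Δ φ) x + ((Z * potential W x : ℝ) : ℂ) * φ x

variable {R : ℝ}

theorem contDiffAt_two (φ : 𝓓(puncturedOmega R, ℂ)) (x : E4) : ContDiffAt ℝ 2 φ x :=
  (φ.contDiff.of_le (WithTop.coe_le_coe.2 (le_top : (2 : ℕ∞) ≤ ⊤))).contDiffAt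

theorem memLp_testFunction (φ : 𝓓(puncturedOmega R, ℂ)) : MemLp φ 2 (vol R) :=
  φ.continuous.memLp_of_hasCompactSupport φ.hasCompactSupport

theorem memLp_laplacian (φ : 𝓓(puncturedOmega R, ℂ)) : MemLp (Δ (φ : E4 → ℂ)) 2 (vol R) := by
  have h2 : ContDiff ℝ 2 φ := φ.contDiff.of_le (WithTop.coe_le_coe.2 (le_top : (2 : ℕ∞) ≤ ⊤))
  have hc : Continuous (iteratedFDeriv ℝ 2 φ) := h2.continuous_iteratedFDeriv le_rfl
  rw [InnerProductSpace.laplacian_eq_iteratedFDeriv_stdOrthonormalBasis]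
  refine Continuous.memLp_of_hasCompactSupport (by fun_prop) ?_
  refine HasCompactSupport.mono' (φ.hasCompactSupport.iteratedFDeriv (𝕜 := ℝ) 2) ?_
  refine subset_trans ?_ subset_closure
  intro x hx h0
  apply hx
  have h0' : iteratedFDeriv ℝ 2 φ x = 0 := by simpa using h0
  simp [h0']

theorem memLp_coulomb (φ : 𝓓(puncturedOmega R, ℂ)) :
    MemLp (fun x => ((-1 / ‖x‖ ^ 2 : ℝ) : ℂ) * φ x) 2 (vol R) := by
  refine Continuous.memLp_of_hasCompactSupport ?_ φ.hasCompactSupport.mul_left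
  rw [continuous_iff_continuousAt]
  intro x
  by_cases hx : x = 0
  · have h0 : (0 : E4) ∉ tsupport φ := fun h => (φ.tsupport_subset h).2 rfl
    have hev := notMem_tsupport_iff_eventuallyEq.1 h0
    subst hx
    refine (continuousAt_const (y := (0 : ℂ))).congr ?_
    filter_upwards [hev] with y hy
    simp [hy]
  · have hx' : ‖x‖ ^ 2 ≠ 0 := by simpa using hx
    refine ContinuousAt.mul ?_ φ.continuous.continuousAt
    refine Complex.continuous_ofReal.continuousAt.comp ?_
    exact continuousAt_const.div (by fun_prop) hx'

theorem memLp_bounded (W : LInf R) (φ : 𝓓(puncturedOmega R, ℂ)) :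
    MemLp (fun x => ((W x : ℝ) : ℂ) * φ x) 2 (vol R) :=
  (memLp_testFunction φ).mul (p := ∞) ((Lp.memLp W).ofReal (K := ℂ))

/-- `-Δφ + Z V φ` is square-integrable for every test function `φ`. -/
theorem memLp_schrodinger (Z : ℝ) (W : LInf R) (φ : 𝓓(puncturedOmega R, ℂ)) :
    MemLp (schrodinger Z W φ) 2 (vol R) := by
  have h := (memLp_laplacian φ).neg.add
    (((memLp_coulomb φ).add (memLp_bounded W φ)).const_mul (Z : ℂ))
  refine h.ae_eq (Filter.Eventually.of_forall fun x => ?_)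
  simp only [schrodinger, potential, Pi.add_apply, Pi.neg_apply]
  push_cast
  ring

/-- The inclusion of `C_c^∞(Ω ∖ {0})` into `L²(Ω)`. -/
def incl (R : ℝ) : 𝓓(puncturedOmega R, ℂ) →ₗ[ℂ] L2 R where
  toFun φ := (memLp_testFunction φ).toLp φ
  map_add' _ _ := rfl
  map_smul' _ _ := rfl

theorem incl_injective (R : ℝ) : Function.Injective (incl R) := by
  intro φ ψ h
  have hae : (φ : E4 → ℂ) =ᵐ[vol R] ψ :=
    (MemLp.toLp_eq_toLp_iff (memLp_testFunction φ) (memLp_testFunction ψ)).1 h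
  have heq : Set.EqOn φ ψ (Omega R : Set E4) :=
    Measure.eqOn_open_of_ae_eq hae (Omega R).isOpen φ.continuous.continuousOn
      ψ.continuous.continuousOn
  ext x
  by_cases hx : x ∈ (Omega R : Set E4)
  · exact heq hx
  · have h1 : ∀ χ : 𝓓(puncturedOmega R, ℂ), χ x = 0 := fun χ =>
      image_eq_zero_of_notMem_tsupport fun hm => hx (χ.tsupport_subset hm).1
    rw [h1 φ, h1 ψ]

/-- The map `φ ↦ -Δφ + Z V φ` from `C_c^∞(Ω ∖ {0})` to `L²(Ω)`. -/
def action (Z : ℝ) (W : LInf R) : 𝓓(puncturedOmega R, ℂ) →ₗ[ℂ] L2 R where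
  toFun φ := (memLp_schrodinger Z W φ).toLp (schrodinger Z W φ)
  map_add' φ ψ := by
    rw [← MemLp.toLp_add]
    congr 1
    funext x
    simp only [schrodinger, Pi.add_apply, FunLike.coe_add,
      (contDiffAt_two φ x).laplacian_add (contDiffAt_two ψ x)]
    ring
  map_smul' c φ := by
    rw [RingHom.id_apply, ← MemLp.toLp_const_smul]
    congr 1
    funext x
    simp only [schrodinger, Pi.smul_apply, FunLike.coe_smul, smul_eq_mul,
      InnerProductSpace.laplacian_smul c (contDiffAt_two φ x)]
    ring

/-- The minimal operator `-Δ + Z V` in `L²(Ω)` with domain `C_c^∞(Ω ∖ {0})`. -/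
def minimalOperator (Z : ℝ) (W : LInf R) : L2 R →ₗ.[ℂ] L2 R where
  domain := LinearMap.range (incl R)
  toFun := action Z W ∘ₗ (LinearEquiv.ofInjective (incl R) (incl_injective R)).symm.toLinearMap

/-- On (the class of) a test function `φ`, the minimal operator is `-Δφ + Z V φ`. -/
theorem minimalOperator_apply (Z : ℝ) (W : LInf R) (φ : 𝓓(puncturedOmega R, ℂ)) :
    minimalOperator Z W ⟨incl R φ, φ, rfl⟩ = action Z W φ := by
  exact congrArg (action Z W)
    ((LinearEquiv.ofInjective (incl R) (incl_injective R)).symm_apply_apply φ)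

/-- The resolvent set of an unbounded operator `T`: the `z` for which `T - z` is a bijection of the
domain of `T` onto the whole space with an everywhere defined bounded inverse `S`. -/
def resolventSet {H : Type*} [NormedAddCommGroup H] [NormedSpace ℂ H] (T : H →ₗ.[ℂ] H) : Set ℂ :=
  {z | ∃ S : H →L[ℂ] H, (∀ x : T.domain, S (T x - z • (x : H)) = x) ∧
    ∀ y : H, ∃ h : S y ∈ T.domain, T ⟨S y, h⟩ - z • S y = y}

/-- The spectrum of an unbounded operator. -/
def opSpectrum {H : Type*} [NormedAddCommGroup H] [NormedSpace ℂ H] (T : H →ₗ.[ℂ] H) : Set ℂ :=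
  (resolventSet T)ᶜ

end CompactHydrogen

end

/-! If `σ(H)` were bounded on one side, a real half-line would lie in the resolvent set and the form
of `H - l` would have a fixed sign, in particular on test functions
(`form_nonneg_of_halfLine_subset_resolventSet`). Radial test functions exclude this.

For `u = |x|⁻¹ f(log |x|)`, the form of `-Δ - Z/|x|²` is a positive multiple of `∫ (f'² - (Z - 1)
f²) dt`: in dimension 4 the Hardy constant is 1, and `Z > 1` exceeds it. Translating `f` towards
`-∞` concentrates `u` at the origin. It preserves this integral, while `‖u‖²`, and with it the
contributions of `W` and `l`, tends to 0 (`integral_radial_form`). So the integral would have the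
same fixed sign for every `f`; but on `f(t) = g(L t)` it is negative for small `L` and positive for
large `L` (`not_form_bounded`). -/

namespace CompactHydrogen

/-! ### Resolvent half-lines and the sign of the quadratic form -/

section Abstract

variable {E : Type*} [NormedAddCommGroup E]

/-- Evaluate `S' (T - w) = 1` at `S y`. Only a right inverse at `z` and a left inverse at `w` are
needed. -/
theorem resolvent_sub_resolvent [NormedSpace ℂ E] {T : E →ₗ.[ℂ] E} {z w : ℂ} {S S' : E →L[ℂ] E}
    (hS : ∀ y : E, ∃ h : S y ∈ T.domain, T ⟨S y, h⟩ - z • S y = y)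
    (hS' : ∀ x : T.domain, S' (T x - w • (x : E)) = x) (y : E) :
    S' y - S y = (w - z) • S' (S y) := by
  obtain ⟨h, e⟩ := hS y
  have h1 := hS' ⟨S y, h⟩
  have h2 : T ⟨S y, h⟩ - w • S y = y - (w - z) • S y := by
    nth_rewrite 3 [← e]
    module
  rw [h2, map_sub, map_smul] at h1
  have h3 : S' y - (w - z) • S' (S y) = S y := h1
  exact sub_eq_iff_eq_add.2 (sub_eq_iff_eq_add'.1 h3)

variable [InnerProductSpace ℂ E] [CompleteSpace E]

/-- If a real half-line ending at `l` lies in the resolvent set of a self-adjoint operator `T`,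
then the quadratic form of `T - l` has the corresponding sign. -/
theorem form_nonneg_of_halfLine_subset_resolventSet {T : E →ₗ.[ℂ] E} (hT : IsSelfAdjoint T)
    {l s : ℝ} (hr : ∀ t : ℝ, 0 ≤ s * (l - t) → (t : ℂ) ∈ resolventSet T) (x : T.domain) :
    0 ≤ s * ((⟪(x : E), T x⟫_ℂ).re - l * ‖(x : E)‖ ^ 2) := by
  have hsymm : ∀ x y : T.domain, ⟪T x, (y : E)⟫_ℂ = ⟪(x : E), T y⟫_ℂ := by
    have h := LinearPMap.adjoint_isFormalAdjoint hT.dense_domain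
    rw [LinearPMap.isSelfAdjoint_def.1 hT] at h
    exact h
  obtain ⟨S, hl, hrt⟩ := hr l (by simp)
  have hSsymm : (S : E →ₗ[ℂ] E).IsSymmetric := by
    intro u v
    obtain ⟨hu, eu⟩ := hrt u
    obtain ⟨hv, ev⟩ := hrt v
    have := hsymm ⟨S u, hu⟩ ⟨S v, hv⟩
    change ⟪S u, v⟫_ℂ = ⟪u, S v⟫_ℂ
    nth_rewrite 1 [← ev]
    nth_rewrite 2 [← eu]
    rw [inner_sub_right, inner_sub_left, inner_smul_left, inner_smul_right, ← this]
    simp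
  have hSsa : IsSelfAdjoint (s • S) :=
    (IsSelfAdjoint.all s).smul (ContinuousLinearMap.isSelfAdjoint_iff_isSymmetric.2 hSsymm)
  have hpos : 0 ≤ s • S := by
    rw [StarOrderedRing.nonneg_iff_spectrum_nonneg (R := ℝ) (s • S) hSsa]
    intro τ hτ
    by_contra hneg
    push Not at hneg
    refine hτ ?_
    -- With `S = (T - l)⁻¹`, `τ - s S = τ (1 - κ S)`, and `1 - κ S` has inverse `1 + κ S'` for `S'`
    -- the resolvent at `l + κ`. As `τ < 0`, that point lies on the half-line.
    set κ : ℝ := s / τ with hκ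
    obtain ⟨S', hl', hrt'⟩ := hr (l + κ) (by
      have : s * (l - (l + κ)) = s ^ 2 / (-τ) := by rw [hκ]; field_simp; ring
      rw [this]
      have : 0 < -τ := by linarith
      positivity)
    have e1 : ∀ y, S' y - S y = (κ : ℂ) • S' (S y) := fun y => by
      rw [resolvent_sub_resolvent hrt hl' y]; push_cast; congr 1; ring
    have e2 : ∀ y, S y - S' y = -((κ : ℂ) • S (S' y)) := fun y => by
      rw [resolvent_sub_resolvent hrt' hl y, ← neg_smul]; push_cast; congr 1; ring
    have hτ0 : τ ≠ 0 := hneg.ne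
    have hfac : algebraMap ℝ (E →L[ℂ] E) τ - s • S = τ • (1 - (κ : ℂ) • S) := by
      ext y
      have : s = τ * κ := by rw [hκ, mul_div_cancel₀ _ hτ0]
      simp [Algebra.algebraMap_eq_smul_one, smul_sub]
      rw [this, mul_smul]
    have hunit : IsUnit (1 - (κ : ℂ) • S) := by
      refine isUnit_iff_exists.2 ⟨1 + (κ : ℂ) • S', ?_, ?_⟩
      · ext y
        have h3 : (κ : ℂ) • S (S' y) = S' y - S y := by rw [← neg_sub, e2, neg_neg]
        change (y + (κ : ℂ) • S' y) - (κ : ℂ) • S (y + (κ : ℂ) • S' y) = y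
        rw [map_add, map_smul, h3]
        module
      · ext y
        change (y - (κ : ℂ) • S y) + (κ : ℂ) • S' (y - (κ : ℂ) • S y) = y
        rw [map_sub, map_smul, ← e1]
        module
    rw [spectrum.mem_resolventSet_iff, hfac, ← Units.smul_mk0 hτ0, isUnit_smul_iff]
    exact hunit
  -- Positivity of `s S`, tested on `(T - l) x`, is the claim because `S (T - l) x = x`.
  have hp := ((ContinuousLinearMap.nonneg_iff_isPositive _).1 hpos).re_inner_nonneg_left
    (T x - (l : ℂ) • (x : E))
  have hx := hl x
  have h4 : (s • S) (T x - (l : ℂ) • (x : E)) = (s : ℂ) • (x : E) := by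
    rw [smul_apply, hx, Complex.coe_smul]
  rw [h4, inner_smul_left, inner_sub_right, inner_smul_right, inner_self_eq_norm_sq_to_K,
    Complex.conj_ofReal] at hp
  have h5 : RCLike.re ((s : ℂ) * (⟪(x : E), T x⟫_ℂ - (l : ℂ) * ((‖(x : E)‖ : ℝ) : ℂ) ^ 2))
      = s * ((⟪(x : E), T x⟫_ℂ).re - l * ‖(x : E)‖ ^ 2) := by
    change ((s : ℂ) * (⟪(x : E), T x⟫_ℂ - (l : ℂ) * ((‖(x : E)‖ : ℝ) : ℂ) ^ 2)).re = _
    rw [Complex.re_ofReal_mul, Complex.sub_re]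
    norm_cast
  rw [← h5]
  exact hp

end Abstract

/-! ### Radial functions in logarithmic coordinates -/

noncomputable section Radial

theorem laplacian_comp_norm_sq {E : Type*} [NormedAddCommGroup E] [InnerProductSpace ℝ E]
    [FiniteDimensional ℝ E] {G G' : ℝ → ℝ} {c : ℝ} {x : E}
    (hG : ∀ᶠ t in nhds (‖x‖ ^ 2), HasDerivAt G (G' t) t) (hG' : HasDerivAt G' c (‖x‖ ^ 2)) :
    (Δ (fun y : E => G (‖y‖ ^ 2))) x
      = 4 * ‖x‖ ^ 2 * c + 2 * Module.finrank ℝ E * G' (‖x‖ ^ 2) := by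
  -- `innerSL ℝ` is typed as conjugate-linear; `J` is the same map typed as `ℝ`-linear, so that the
  -- derivative rules apply.
  obtain ⟨J, hJ⟩ : ∃ J : E →L[ℝ] E →L[ℝ] ℝ, ∀ y, J y = innerSL ℝ y :=
    ⟨innerSL ℝ, fun _ => rfl⟩
  have hN : ∀ y : E, HasFDerivAt (fun y : E => ‖y‖ ^ 2) ((2 : ℝ) • J y) y := fun y => by
    rw [hJ, ofNat_smul_eq_nsmul]
    exact (hasStrictFDerivAt_norm_sq y).hasFDerivAt
  have hcont : Filter.Tendsto (fun y : E => ‖y‖ ^ 2) (nhds x) (nhds (‖x‖ ^ 2)) :=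
    (hN x).continuousAt
  have h1 : fderiv ℝ (fun y : E => G (‖y‖ ^ 2)) =ᶠ[nhds x]
      fun y => G' (‖y‖ ^ 2) • (2 : ℝ) • J y := by
    filter_upwards [hcont.eventually hG] with y hy
    exact (hy.comp_hasFDerivAt y (hN y)).fderiv
  have h2 : HasFDerivAt (fun y : E => G' (‖y‖ ^ 2) • (2 : ℝ) • J y)
      (G' (‖x‖ ^ 2) • (2 : ℝ) • J
        + (c • (2 : ℝ) • J x).smulRight ((2 : ℝ) • J x)) x :=
    (hG'.comp_hasFDerivAt x (hN x)).smul
      (J.hasFDerivAt.const_smul (2 : ℝ))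
  have h3 : ∀ v : E, iteratedFDeriv ℝ 2 (fun y : E => G (‖y‖ ^ 2)) x ![v, v]
      = 2 * G' (‖x‖ ^ 2) * ‖v‖ ^ 2 + 4 * c * ⟪x, v⟫_ℝ ^ 2 := by
    intro v
    rw [iteratedFDeriv_two_apply, h1.fderiv_eq, h2.fderiv]
    simp [hJ, innerSL_apply_apply]
    ring
  rw [InnerProductSpace.laplacian_eq_iteratedFDeriv_stdOrthonormalBasis]
  simp only [h3, Finset.sum_add_distrib, ← Finset.mul_sum, OrthonormalBasis.norm_eq_one,
    OrthonormalBasis.sum_sq_inner_left]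
  simp
  ring

/-- The function `x ↦ |x|⁻¹ f(log |x|)`. -/
def radialFun (f : ℝ → ℝ) (x : E4) : ℝ := ‖x‖⁻¹ * f (Real.log ‖x‖)

/-- The exponent in `|x|⁻¹` is `-(n - 2)/2` for `n = 4`, which cancels the first-order term in `t =
log |x|`. The remaining `-f` carries the Hardy constant `((n - 2)/2)² = 1`. -/
theorem laplacian_radialFun {f : ℝ → ℝ} (hf : ContDiff ℝ 2 f) {x : E4} (hx : x ≠ 0) :
    (Δ (radialFun f)) x
      = ‖x‖⁻¹ ^ 3 * (deriv (deriv f) (Real.log ‖x‖) - f (Real.log ‖x‖)) := by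
  have hd : ∀ t, HasDerivAt f (deriv f t) t := fun t =>
    ((hf.differentiable (by norm_num)) t).hasDerivAt
  have hdd : ∀ t, HasDerivAt (deriv f) (deriv (deriv f) t) t := fun t =>
    (((contDiff_succ_iff_deriv (n := 1)).1 hf).2.2.differentiable (by norm_num) t).hasDerivAt
  have hlog : ∀ t : ℝ, 0 < t → HasDerivAt (fun t => Real.log t / 2) (t⁻¹ / 2) t := fun t ht =>
    (Real.hasDerivAt_log ht.ne').div_const 2
  have hexp : ∀ t : ℝ, 0 < t → HasDerivAt (fun t => Real.exp (-(Real.log t / 2)))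
      (Real.exp (-(Real.log t / 2)) * -(t⁻¹ / 2)) t := fun t ht => (hlog t ht).neg.exp
  have hpos : 0 < ‖x‖ := norm_pos_iff.2 hx
  have key := laplacian_comp_norm_sq (x := x)
    (G := fun t => Real.exp (-(Real.log t / 2)) * f (Real.log t / 2))
    (G' := fun t => Real.exp (-(Real.log t / 2)) * -(t⁻¹ / 2) * f (Real.log t / 2)
      + Real.exp (-(Real.log t / 2)) * (deriv f (Real.log t / 2) * (t⁻¹ / 2)))
    (c := _)
    (by
      filter_upwards [lt_mem_nhds (pow_pos hpos 2)] with t ht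
      exact (hexp t ht).mul ((hd _).comp t (hlog t ht)))
    (by
      have ht := pow_pos hpos 2
      have hi := (hasDerivAt_inv ht.ne').div_const 2
      exact (((hexp _ ht).mul hi.neg).mul ((hd _).comp _ (hlog _ ht))).add
        ((hexp _ ht).mul (((hdd _).comp _ (hlog _ ht)).mul hi)))
  have hl : ∀ y : E4, Real.log (‖y‖ ^ 2) / 2 = Real.log ‖y‖ := fun y => by
    rw [Real.log_pow]; push_cast; ring
  have heq : radialFun f =ᶠ[nhds x] fun y : E4 =>
      Real.exp (-(Real.log (‖y‖ ^ 2) / 2)) * f (Real.log (‖y‖ ^ 2) / 2) := by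
    filter_upwards [isOpen_ne.mem_nhds hx] with y hy
    rw [hl, Real.exp_neg, Real.exp_log (norm_pos_iff.2 hy), radialFun]
  rw [(InnerProductSpace.laplacian_congr_nhds heq).self_of_nhds, key]
  simp only [Function.comp, Pi.neg_apply, Pi.mul_apply, hl, Real.exp_neg, Real.exp_log hpos, finrank_euclideanSpace,
    Fintype.card_fin]
  field_simp
  ring

theorem contDiff_radialFun {f : ℝ → ℝ} {n : ℕ∞} (hf : ContDiff ℝ n f) {A B : ℝ}
    (hAB : ∀ t, f t ≠ 0 → t ∈ Set.Icc A B) : ContDiff ℝ n (radialFun f) := by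
  rw [contDiff_iff_contDiffAt]
  intro x
  by_cases hx : x = 0
  · subst hx
    refine (contDiffAt_const (c := (0 : ℝ))).congr_of_eventuallyEq ?_
    filter_upwards [Metric.ball_mem_nhds (0 : E4) (Real.exp_pos A)] with y hy
    by_contra hne
    have hf0 := hAB _ (right_ne_zero_of_mul hne)
    have hy0 : 0 < ‖y‖ := norm_pos_iff.2 fun h => hne (by simp [radialFun, h])
    rw [mem_ball_zero_iff] at hy
    exact absurd ((Real.le_log_iff_exp_le hy0).1 hf0.1) (not_le.2 hy)
  · have hn : ‖x‖ ≠ 0 := norm_ne_zero_iff.2 hx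
    have h1 : ContDiffAt ℝ n (fun y : E4 => ‖y‖) x := contDiffAt_norm ℝ hx
    exact (h1.inv hn).mul (hf.contDiffAt.comp x (h1.log hn))

theorem radialFun_support {f : ℝ → ℝ} {A B : ℝ} (hAB : ∀ t, f t ≠ 0 → t ∈ Set.Icc A B) :
    tsupport (radialFun f) ⊆ {x | Real.exp A ≤ ‖x‖ ∧ ‖x‖ ≤ Real.exp B} := by
  refine closure_minimal ?_
    ((isClosed_le continuous_const continuous_norm).inter
      (isClosed_le continuous_norm continuous_const))
  intro y hne
  have hf0 := hAB _ (right_ne_zero_of_mul hne)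
  have hy0 : 0 < ‖y‖ := norm_pos_iff.2 fun h => hne (by simp [radialFun, h])
  exact ⟨(Real.le_log_iff_exp_le hy0).1 hf0.1, (Real.log_le_iff_le_exp hy0).1 hf0.2⟩

/-- Polar coordinates with `r = exp t`: `r⁻⁴ r³ dr = dt`, and `4 |B₁|` is the area of the unit
sphere. -/
theorem integral_comp_log_norm (h : ℝ → ℝ) :
    ∫ x : E4, ‖x‖⁻¹ ^ 4 * h (Real.log ‖x‖)
      = 4 * volume.real (Metric.ball (0 : E4) 1) * ∫ t, h t := by
  rw [integral_fun_norm_addHaar volume (fun r => r⁻¹ ^ 4 * h (Real.log r))]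
  have h1 := integral_image_eq_integral_deriv_smul_of_monotoneOn (s := Set.univ) (f := Real.exp)
    (f' := Real.exp) MeasurableSet.univ (fun x _ => (Real.hasDerivAt_exp x).hasDerivWithinAt)
    (Real.exp_monotone.monotoneOn _) (fun r => r ^ 3 * (r⁻¹ ^ 4 * h (Real.log r)))
  rw [Set.image_univ, Real.range_exp, Measure.restrict_univ] at h1
  simp only [finrank_euclideanSpace, Fintype.card_fin, smul_eq_mul, nsmul_eq_mul]
  rw [h1]
  simp only [Real.log_exp, smul_eq_mul]
  rw [mul_assoc]
  push_cast
  congr 3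
  ext t
  have := (Real.exp_pos t).ne'
  field_simp

end Radial

/-! ### The quadratic form on radial test functions -/

noncomputable section FormEstimate

variable {R : ℝ}

theorem ball_subset_Omega : {x : E4 | ‖x‖ < Real.pi * R} ⊆ Omega R := by
  intro x hx
  have h : |x 3| ≤ ‖x‖ := by simpa using PiLp.norm_apply_le x 3
  exact abs_lt.1 (h.trans_lt hx)

/-- The test function `x ↦ |x|⁻¹ f(log |x|)`. -/
def radialTestFunction {f : ℝ → ℝ} (hf : ContDiff ℝ ∞ f) {A B : ℝ}
    (hAB : ∀ t, f t ≠ 0 → t ∈ Set.Icc A B) (hB : Real.exp B < Real.pi * R) :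
    𝓓(puncturedOmega R, ℂ) where
  toFun x := (radialFun f x : ℂ)
  contDiff' := Complex.ofRealCLM.contDiff.comp (contDiff_radialFun hf hAB)
  hasCompactSupport' := by
    refine HasCompactSupport.comp_left (g := ((↑) : ℝ → ℂ)) ?_ Complex.ofReal_zero
    refine (isCompact_closedBall (0 : E4) (Real.exp B)).of_isClosed_subset (isClosed_tsupport _) ?_
    intro x hx
    exact mem_closedBall_zero_iff.2 (radialFun_support hAB hx).2
  tsupport_subset' := by
    refine (closure_mono (Function.support_comp_subset (g := ((↑) : ℝ → ℂ))
      Complex.ofReal_zero _)).trans fun x hx => ?_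
    have h := radialFun_support hAB hx
    refine ⟨ball_subset_Omega (h.2.trans_lt hB), ?_⟩
    rintro rfl
    simpa using (Real.exp_pos A).trans_le h.1

theorem inner_action (Z : ℝ) (W : LInf R) (φ : 𝓓(puncturedOmega R, ℂ)) :
    ⟪incl R φ, action Z W φ⟫_ℂ = ∫ x, starRingEnd ℂ (φ x) * schrodinger Z W φ x ∂(vol R) := by
  rw [L2.inner_def]
  refine integral_congr_ae ?_
  filter_upwards [(memLp_testFunction φ).coeFn_toLp, (memLp_schrodinger Z W φ).coeFn_toLp]
    with x h1 h2
  have e1 : (incl R φ : L2 R) x = φ x := h1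
  have e2 : (action Z W φ : L2 R) x = schrodinger Z W φ x := h2
  rw [e1, e2, RCLike.inner_apply, mul_comm]

theorem schrodinger_radialTestFunction (Z : ℝ) (W : LInf R) {f : ℝ → ℝ} (hf : ContDiff ℝ ∞ f)
    {A B : ℝ} (hAB : ∀ t, f t ≠ 0 → t ∈ Set.Icc A B) (hB : Real.exp B < Real.pi * R) (x : E4) :
    starRingEnd ℂ (radialTestFunction hf hAB hB x)
        * schrodinger Z W (radialTestFunction hf hAB hB) x
      = ((‖x‖⁻¹ ^ 4 * ((1 - Z) * f (Real.log ‖x‖) ^ 2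
          - f (Real.log ‖x‖) * deriv (deriv f) (Real.log ‖x‖))
        + Z * (W x * radialFun f x ^ 2) : ℝ) : ℂ) := by
  have hφ : (radialTestFunction hf hAB hB : E4 → ℂ) = Complex.ofRealCLM ∘ radialFun f := rfl
  have hf2 : ContDiff ℝ 2 f := hf.of_le (WithTop.coe_le_coe.2 (le_top : (2 : ℕ∞) ≤ ⊤))
  have hu : ContDiffAt ℝ 2 (radialFun f) x :=
    (contDiff_radialFun (n := 2) hf2 hAB).contDiffAt
  rw [schrodinger, hφ, hu.laplacian_CLM_comp_left]
  simp only [Function.comp, Complex.ofRealCLM_apply, Complex.conj_ofReal]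
  norm_cast
  by_cases hx : x = 0
  -- At the origin both sides vanish, since `‖0‖⁻¹ = 0`.
  · simp [hx, radialFun]
  · have hn : ‖x‖ ≠ 0 := norm_ne_zero_iff.2 hx
    rw [laplacian_radialFun hf2 hx, potential, radialFun]
    field_simp
    ring

theorem integrable_comp_log_norm {h : ℝ → ℝ} (hc : Continuous h) {A B : ℝ}
    (hAB : ∀ t, h t ≠ 0 → t ∈ Set.Icc A B) :
    Integrable (fun x : E4 => ‖x‖⁻¹ ^ 4 * h (Real.log ‖x‖)) := by
  -- Absorbing `|x|⁻³` into the profile reuses the regularity and support results for `radialFun`.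
  have h1 : (fun x : E4 => ‖x‖⁻¹ ^ 4 * h (Real.log ‖x‖))
      = radialFun (fun t => Real.exp (-(3 * t)) * h t) := by
    ext x
    by_cases hx : x = 0
    · simp [hx, radialFun]
    · have hn : 0 < ‖x‖ := norm_pos_iff.2 hx
      have h3 : Real.exp (3 * Real.log ‖x‖) = ‖x‖ ^ 3 := by
        rw [← Real.exp_log (pow_pos hn 3), Real.log_pow]
        push_cast
        rfl
      rw [radialFun, Real.exp_neg, h3]
      field_simp
  have hAB' : ∀ t, Real.exp (-(3 * t)) * h t ≠ 0 → t ∈ Set.Icc A B := fun t ht =>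
    hAB t (right_ne_zero_of_mul ht)
  rw [h1]
  refine Continuous.integrable_of_hasCompactSupport ?_ ?_
  · exact (contDiff_radialFun (n := 0) (contDiff_zero.2 (by fun_prop)) hAB').continuous
  · exact (isCompact_closedBall (0 : E4) (Real.exp B)).of_isClosed_subset (isClosed_tsupport _)
      fun x hx => mem_closedBall_zero_iff.2 (radialFun_support hAB' hx).2

theorem integral_vol_comp_log_norm {h : ℝ → ℝ} {A B : ℝ}
    (hAB : ∀ t, h t ≠ 0 → t ∈ Set.Icc A B) (hB : Real.exp B < Real.pi * R) :
    ∫ x, ‖x‖⁻¹ ^ 4 * h (Real.log ‖x‖) ∂(vol R)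
      = 4 * volume.real (Metric.ball (0 : E4) 1) * ∫ t, h t := by
  rw [← integral_comp_log_norm]
  refine setIntegral_eq_integral_of_forall_compl_eq_zero fun x hx => ?_
  by_contra hne
  have hh := hAB _ (right_ne_zero_of_mul hne)
  have hn : 0 < ‖x‖ := norm_pos_iff.2 fun h0 => hne (by simp [h0])
  exact hx (ball_subset_Omega (((Real.log_le_iff_le_exp hn).1 hh.2).trans_lt hB))

theorem integrable_radialFun_sq {f : ℝ → ℝ} (hf : ContDiff ℝ ∞ f)
    {A B : ℝ} (hAB : ∀ t, f t ≠ 0 → t ∈ Set.Icc A B) (hB : Real.exp B < Real.pi * R) :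
    Integrable (fun x => radialFun f x ^ 2) (vol R) := by
  have h := (memLp_testFunction (radialTestFunction hf hAB hB)).integrable_norm_pow (by norm_num)
  refine h.congr (Filter.Eventually.of_forall fun x => ?_)
  change ‖(radialFun f x : ℂ)‖ ^ 2 = _
  simp

theorem norm_incl_radialTestFunction_sq {f : ℝ → ℝ} (hf : ContDiff ℝ ∞ f)
    {A B : ℝ} (hAB : ∀ t, f t ≠ 0 → t ∈ Set.Icc A B) (hB : Real.exp B < Real.pi * R) :
    ‖incl R (radialTestFunction hf hAB hB)‖ ^ 2 = ∫ x, radialFun f x ^ 2 ∂(vol R) := by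
  have h : ⟪incl R (radialTestFunction hf hAB hB), incl R (radialTestFunction hf hAB hB)⟫_ℂ
      = ((∫ x, radialFun f x ^ 2 ∂(vol R) : ℝ) : ℂ) := by
    rw [L2.inner_def, ← integral_complex_ofReal]
    refine integral_congr_ae ?_
    filter_upwards [(memLp_testFunction (radialTestFunction hf hAB hB)).coeFn_toLp] with x h1
    have e1 : (incl R (radialTestFunction hf hAB hB) : L2 R) x = (radialFun f x : ℂ) := h1
    rw [e1, RCLike.inner_apply, Complex.conj_ofReal]
    push_cast
    ring
  rw [inner_self_eq_norm_sq_to_K] at h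
  refine Complex.ofReal_injective ?_
  rw [← h]
  push_cast
  rfl

/-- Here `u² = |x|⁻⁴ |x|² f²` and `|x| ≤ exp B` on the support. The factor `exp B ^ 2` makes the
mass negligible near the origin. -/
theorem integral_radialFun_sq_le {f : ℝ → ℝ} (hf : ContDiff ℝ ∞ f)
    {A B : ℝ} (hAB : ∀ t, f t ≠ 0 → t ∈ Set.Icc A B) (hB : Real.exp B < Real.pi * R) :
    ∫ x, radialFun f x ^ 2 ∂(vol R)
      ≤ 4 * volume.real (Metric.ball (0 : E4) 1) * (Real.exp B ^ 2 * ∫ t, f t ^ 2) := by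
  have hAB' : ∀ t, Real.exp B ^ 2 * f t ^ 2 ≠ 0 → t ∈ Set.Icc A B := fun t ht =>
    hAB t fun h => ht (by simp [h])
  have hc := hf.continuous
  rw [← integral_const_mul, ← integral_vol_comp_log_norm hAB' hB]
  refine integral_mono (integrable_radialFun_sq hf hAB hB)
    (integrable_comp_log_norm (by fun_prop) hAB').integrableOn fun x => ?_
  by_cases h0 : radialFun f x = 0
  · simp only [h0, ne_eq, OfNat.ofNat_ne_zero, not_false_eq_true, zero_pow]
    positivity
  have hh := hAB _ (right_ne_zero_of_mul h0)
  have hn : 0 < ‖x‖ := norm_pos_iff.2 fun h => h0 (by simp [radialFun, h])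
  have hle := (Real.log_le_iff_le_exp hn).1 hh.2
  have h2 : ‖x‖ ^ 2 ≤ Real.exp B ^ 2 := by gcongr
  have h3 : radialFun f x ^ 2 = ‖x‖⁻¹ ^ 4 * (‖x‖ ^ 2 * f (Real.log ‖x‖) ^ 2) := by
    rw [radialFun]
    field_simp
  simp only [h3]
  gcongr

/-- A one-sided bound for the quadratic form on `C_c^∞(Ω ∖ {0})`, evaluated on the functions
`|x|⁻¹ f(log |x|)`. -/
theorem radial_form_inequality {Z : ℝ} {W : LInf R} {s l : ℝ} (hs : |s| = 1)
    (hform : ∀ φ : 𝓓(puncturedOmega R, ℂ),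
      0 ≤ s * ((⟪incl R φ, action Z W φ⟫_ℂ).re - l * ‖incl R φ‖ ^ 2))
    {f : ℝ → ℝ} (hf : ContDiff ℝ ∞ f)
    {A B : ℝ} (hAB : ∀ t, f t ≠ 0 → t ∈ Set.Icc A B) (hB : Real.exp B < Real.pi * R) :
    0 ≤ s * (∫ t, ((1 - Z) * f t ^ 2 - f t * deriv (deriv f) t))
      + (|Z| * ‖W‖ + |l|) * (Real.exp B ^ 2 * ∫ t, f t ^ 2) := by
  set h : ℝ → ℝ := fun t => (1 - Z) * f t ^ 2 - f t * deriv (deriv f) t with hh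
  have hAB' : ∀ t, h t ≠ 0 → t ∈ Set.Icc A B := fun t ht => hAB t fun h0 => ht (by simp [hh, h0])
  have hc := hf.continuous
  have hc2 : Continuous (deriv (deriv f)) := by
    have := hf.continuous_iteratedDeriv 2 (WithTop.coe_le_coe.2 (le_top : (2 : ℕ∞) ≤ ⊤))
    rwa [iteratedDeriv_succ, iteratedDeriv_one] at this
  have hi := (integrable_comp_log_norm (h := h) (by fun_prop) hAB').integrableOn
    (s := (Omega R : Set E4))
  have hu := integrable_radialFun_sq hf hAB hB
  have hW : ∀ᵐ x ∂(vol R), |W x| ≤ ‖W‖ := by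
    have := ae_le_lpNorm_exponent_top (Lp.memLp W)
    filter_upwards [this] with x hx
    rw [Lp.norm_def, toReal_eLpNorm (Lp.aestronglyMeasurable W)]
    exact hx
  have hWu : Integrable (fun x => W x * radialFun f x ^ 2) (vol R) :=
    hu.bdd_mul (Lp.memLp W).1 hW
  have h1 := hform (radialTestFunction hf hAB hB)
  rw [inner_action, norm_incl_radialTestFunction_sq] at h1
  simp only [schrodinger_radialTestFunction] at h1
  rw [integral_complex_ofReal, Complex.ofReal_re, integral_add hi (hWu.const_mul Z),
    integral_vol_comp_log_norm hAB' hB, integral_const_mul] at h1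
  have h2 := integral_radialFun_sq_le hf hAB hB
  have h3 : |∫ x, W x * radialFun f x ^ 2 ∂(vol R)|
      ≤ ‖W‖ * ∫ x, radialFun f x ^ 2 ∂(vol R) := by
    rw [← integral_const_mul, ← Real.norm_eq_abs]
    refine norm_integral_le_of_norm_le (hu.const_mul _) ?_
    filter_upwards [hW] with x hx
    rw [norm_mul, Real.norm_eq_abs, Real.norm_of_nonneg (sq_nonneg _)]
    gcongr
  have h4 : 0 ≤ ∫ x, radialFun f x ^ 2 ∂(vol R) := integral_nonneg fun x => sq_nonneg _
  set U := ∫ x, radialFun f x ^ 2 ∂(vol R)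
  set V := ∫ x, W x * radialFun f x ^ 2 ∂(vol R)
  have hC : 0 < 4 * volume.real (Metric.ball (0 : E4) 1) := by
    have : 0 < volume.real (Metric.ball (0 : E4) 1) :=
      ENNReal.toReal_pos (Metric.measure_ball_pos _ _ one_pos).ne' measure_ball_lt_top.ne
    positivity
  set C := 4 * volume.real (Metric.ball (0 : E4) 1)
  have h5 : s * (Z * V) ≤ |Z| * ‖W‖ * U := by
    calc s * (Z * V) ≤ |s * (Z * V)| := le_abs_self _
      _ = |Z| * |V| := by rw [abs_mul, abs_mul, hs, one_mul]
      _ ≤ |Z| * (‖W‖ * U) := by gcongr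
      _ = _ := by ring
  have h6 : -(s * (l * U)) ≤ |l| * U := by
    calc -(s * (l * U)) ≤ |s * (l * U)| := neg_le_abs _
      _ = |l| * U := by rw [abs_mul, abs_mul, hs, one_mul, abs_of_nonneg h4]
  have h7 : (|Z| * ‖W‖ + |l|) * U
      ≤ (|Z| * ‖W‖ + |l|) * (C * (Real.exp B ^ 2 * ∫ t, f t ^ 2)) := by gcongr
  refine nonneg_of_mul_nonneg_right ?_ hC
  linarith

/-- Apply `radial_form_inequality` to `f(· + τ)` and let `τ → ∞`. The main integral is translation
invariant, the error carries `exp (B - τ) ^ 2`, and the support eventually fits inside `Ω`, so `B`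
is unrestricted. -/
theorem integral_radial_form {Z : ℝ} {W : LInf R} {s l : ℝ} (hR : 0 < R) (hs : |s| = 1)
    (hform : ∀ φ : 𝓓(puncturedOmega R, ℂ),
      0 ≤ s * ((⟪incl R φ, action Z W φ⟫_ℂ).re - l * ‖incl R φ‖ ^ 2))
    {f : ℝ → ℝ} (hf : ContDiff ℝ ∞ f)
    {A B : ℝ} (hAB : ∀ t, f t ≠ 0 → t ∈ Set.Icc A B) :
    0 ≤ s * ∫ t, ((1 - Z) * f t ^ 2 - f t * deriv (deriv f) t) := by
  have hexp : Filter.Tendsto (fun τ => Real.exp (B - τ)) Filter.atTop (nhds 0) :=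
    by
    simp only [sub_eq_add_neg]
    exact Real.tendsto_exp_atBot.comp
      (Filter.tendsto_atBot_add_const_left _ B Filter.tendsto_neg_atTop_atBot)
  have hlim : Filter.Tendsto (fun τ => s * (∫ t, ((1 - Z) * f t ^ 2 - f t * deriv (deriv f) t))
      + (|Z| * ‖W‖ + |l|) * (Real.exp (B - τ) ^ 2 * ∫ t, f t ^ 2)) Filter.atTop
      (nhds (s * (∫ t, ((1 - Z) * f t ^ 2 - f t * deriv (deriv f) t))
      + (|Z| * ‖W‖ + |l|) * (0 ^ 2 * ∫ t, f t ^ 2))) :=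
    (((hexp.pow 2).mul_const _).const_mul _).const_add _
  have h0 : 0 ≤ s * (∫ t, ((1 - Z) * f t ^ 2 - f t * deriv (deriv f) t))
      + (|Z| * ‖W‖ + |l|) * (0 ^ 2 * ∫ t, f t ^ 2) := by
    refine ge_of_tendsto hlim ?_
    filter_upwards [hexp.eventually (gt_mem_nhds (mul_pos Real.pi_pos hR))] with τ hτ
    have h1 := radial_form_inequality hs hform (f := fun t => f (t + τ)) (A := A - τ)
      (hf.comp (contDiff_id.add contDiff_const))
      (fun t ht => ⟨by linarith [(hAB _ ht).1], by linarith [(hAB _ ht).2]⟩) hτ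
    have h2 : deriv (deriv fun t => f (t + τ)) = fun t => deriv (deriv f) (t + τ) := by
      ext t
      have : (deriv fun t => f (t + τ)) = fun t => deriv f (t + τ) := by
        ext t
        exact deriv_comp_add_const ..
      rw [this]
      exact deriv_comp_add_const ..
    rw [h2, integral_add_right_eq_self (fun t => f t ^ 2) τ,
      integral_add_right_eq_self (fun t => (1 - Z) * f t ^ 2 - f t * deriv (deriv f) t) τ] at h1
    exact h1
  simpa using h0

/-- For `Z > 1` the quadratic form of `-Δ + Z V` on `C_c^∞(Ω ∖ {0})` has neither a lower bound
(`s = 1`) nor an upper bound (`s = -1`). -/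
theorem not_form_bounded {Z : ℝ} (hZ : 1 < Z) {W : LInf R} {s l : ℝ} (hR : 0 < R) (hs : |s| = 1) :
    ¬ ∀ φ : 𝓓(puncturedOmega R, ℂ),
      0 ≤ s * ((⟪incl R φ, action Z W φ⟫_ℂ).re - l * ‖incl R φ‖ ^ 2) := by
  intro hform
  let g : ContDiffBump (0 : ℝ) := default
  have hg : ContDiff ℝ ∞ g := g.contDiff
  have hgs : ∀ t, g t ≠ 0 → t ∈ Set.Icc (-g.rOut) g.rOut := fun t ht => by
    have : t ∈ Function.support g := ht
    rw [g.support_eq, mem_ball_zero_iff, Real.norm_eq_abs, abs_lt] at this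
    exact ⟨this.1.le, this.2.le⟩
  have hgc : HasCompactSupport g := g.hasCompactSupport
  have hg1 : ContDiff ℝ ∞ (deriv g) := (contDiff_infty_iff_deriv.1 hg).2
  have hg2 : ContDiff ℝ ∞ (deriv (deriv g)) := (contDiff_infty_iff_deriv.1 hg1).2
  have hd : ∀ t, HasDerivAt g (deriv g t) t := fun t =>
    (hg.differentiable (by simp) t).hasDerivAt
  have hdd : ∀ t, HasDerivAt (deriv g) (deriv (deriv g) t) t := fun t =>
    (hg1.differentiable (by simp) t).hasDerivAt
  set a := ∫ t, deriv g t * deriv g t with ha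
  set b := ∫ t, g t ^ 2 with hb
  have hib : Integrable fun t => g t ^ 2 := by
    refine Continuous.integrable_of_hasCompactSupport (by fun_prop) ?_
    exact hgc.comp_left (g := fun y : ℝ => y ^ 2) (by simp)
  have hia : Integrable fun t => deriv g t * deriv g t :=
    (hg1.continuous.mul hg1.continuous).integrable_of_hasCompactSupport hgc.deriv.mul_right
  have hic : Integrable fun t => g t * deriv (deriv g) t :=
    (hg.continuous.mul hg2.continuous).integrable_of_hasCompactSupport hgc.mul_right
  have hparts : ∫ t, g t * deriv (deriv g) t = -a :=
    integral_mul_deriv_eq_deriv_mul_of_integrable (fun t _ => hd t) (fun t _ => hdd t) hic hia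
      ((hg.continuous.mul hg1.continuous).integrable_of_hasCompactSupport hgc.mul_right)
  have hb0 : 0 < b := by
    refine hg.continuous.pow 2 |>.integral_pos_of_hasCompactSupport_nonneg_nonzero
      (hgc.comp_left (g := fun y : ℝ => y ^ 2) (by simp)) (fun t => sq_nonneg _) (x := 0) ?_
    have := g.pos_of_mem_ball (Metric.mem_ball_self g.rOut_pos)
    positivity
  have ha0 : 0 < a := by
    have hne : ∃ t, deriv g t ≠ 0 := by
      by_contra! hall
      have h0 := is_const_of_deriv_eq_zero (hg.differentiable (by simp)) hall 0 g.rOut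
      have h1 := g.pos_of_mem_ball (Metric.mem_ball_self g.rOut_pos)
      rw [h0, g.zero_of_le_dist (by simp [abs_of_pos g.rOut_pos])] at h1
      exact h1.false
    obtain ⟨t, ht⟩ := hne
    exact (hg1.continuous.mul hg1.continuous).integral_pos_of_hasCompactSupport_nonneg_nonzero
      hgc.deriv.mul_right (fun t => mul_self_nonneg _) (mul_self_ne_zero.2 ht)
  -- For `f(t) = g(L t)`, integration by parts and the substitution `L t` give `L⁻¹ ((1 - Z) b + L²
  -- a)`.
  have key : ∀ L : ℝ, 0 < L → 0 ≤ s * ((1 - Z) * b + L ^ 2 * a) := by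
    intro L hL
    have h1 := integral_radial_form hR hs hform (f := fun t => g (L * t)) (A := -g.rOut / L)
      (B := g.rOut / L) (hg.comp (contDiff_const.mul contDiff_id)) (fun t ht => by
        have := hgs _ ht
        exact ⟨(div_le_iff₀' hL).2 this.1, (le_div_iff₀' hL).2 this.2⟩)
    have h2 : deriv (deriv fun t => g (L * t)) = fun t => L ^ 2 * deriv (deriv g) (L * t) := by
      have e1 : (deriv fun t => g (L * t)) = fun t => L * deriv g (L * t) := by
        ext t
        simpa using deriv_comp_mul_left L g t
      ext t
      rw [e1, deriv_const_mul_field, deriv_comp_mul_left]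
      simp
      ring
    rw [h2] at h1
    have h3 : ∫ t, ((1 - Z) * g (L * t) ^ 2 - g (L * t) * (L ^ 2 * deriv (deriv g) (L * t)))
        = L⁻¹ * ((1 - Z) * b + L ^ 2 * a) := by
      have := Measure.integral_comp_mul_left
        (fun t => (1 - Z) * g t ^ 2 - L ^ 2 * (g t * deriv (deriv g) t)) L
      rw [integral_sub (hib.const_mul _) (hic.const_mul _), integral_const_mul,
        integral_const_mul, hparts, abs_of_pos (inv_pos.2 hL), smul_eq_mul] at this
      rw [hb]
      convert this using 2
      · ext t; ring
      · ring
    rw [h3, mul_left_comm] at h1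
    exact nonneg_of_mul_nonneg_right h1 (inv_pos.2 hL)
  have hZb : 0 < (Z - 1) * b := mul_pos (by linarith) hb0
  rcases (abs_eq zero_le_one).1 hs with rfl | rfl
  -- This `L` makes `L² a` half of `(Z - 1) b`, so the form is negative.
  · have h := key (Real.sqrt ((Z - 1) * b / (2 * a))) (by positivity)
    rw [Real.sq_sqrt (by positivity)] at h
    have : (Z - 1) * b / (2 * a) * a = (Z - 1) * b / 2 := by field_simp
    linarith
  -- This `L` makes `L² a` twice `(Z - 1) b`, so the form is positive.
  · have h := key (Real.sqrt (2 * ((Z - 1) * b) / a)) (by positivity)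
    rw [Real.sq_sqrt (by positivity)] at h
    have : 2 * ((Z - 1) * b) / a * a = 2 * ((Z - 1) * b) := by field_simp
    linarith

theorem form_nonneg_of_extension {Z : ℝ} {W : LInf R} {H : L2 R →ₗ.[ℂ] L2 R} (hsa : IsSelfAdjoint H)
    (hext : minimalOperator Z W ≤ H) {l s : ℝ}
    (hr : ∀ t : ℝ, 0 ≤ s * (l - t) → (t : ℂ) ∈ resolventSet H) (φ : 𝓓(puncturedOmega R, ℂ)) :
    0 ≤ s * ((⟪incl R φ, action Z W φ⟫_ℂ).re - l * ‖incl R φ‖ ^ 2) := by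
  have hmem : incl R φ ∈ (minimalOperator Z W).domain := ⟨φ, rfl⟩
  have h := form_nonneg_of_halfLine_subset_resolventSet hsa hr ⟨incl R φ, hext.1 hmem⟩
  have h2 : H ⟨incl R φ, hext.1 hmem⟩ = action Z W φ := by
    rw [← minimalOperator_apply]
    exact (hext.2 rfl).symm
  rwa [h2] at h

end FormEstimate

end CompactHydrogen

theorem mainTheorem4 (R : ℝ) (hR : 0 < R) (W : CompactHydrogen.LInf R) (Z : ℝ) (hZ : 1 < Z)
    (H : CompactHydrogen.L2 R →ₗ.[ℂ] CompactHydrogen.L2 R) (hsa : IsSelfAdjoint H)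
    (hext : CompactHydrogen.minimalOperator Z W ≤ H) :
    ¬ BddBelow {t : ℝ | (t : ℂ) ∈ CompactHydrogen.opSpectrum H} ∧
      ¬ BddAbove {t : ℝ | (t : ℂ) ∈ CompactHydrogen.opSpectrum H} := by
  constructor
  · rintro ⟨c, hc⟩
    -- The bound `c` may itself be spectral; the shift by 1 puts the closed half-line ending at `l`
    -- in the resolvent set.
    refine CompactHydrogen.not_form_bounded hZ (W := W) (s := 1) (l := c - 1) hR (by simp)
      (CompactHydrogen.form_nonneg_of_extension hsa hext fun t ht => ?_)
    by_contra hn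
    have := hc (a := t) hn
    linarith
  · rintro ⟨c, hc⟩
    refine CompactHydrogen.not_form_bounded hZ (W := W) (s := -1) (l := c + 1) hR (by simp)
      (CompactHydrogen.form_nonneg_of_extension hsa hext fun t ht => ?_)
    by_contra hn
    have := hc (a := t) hn
    linarith
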